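/- Let $A$ be a (not necessarily unital) C*-algebra, let $\alpha \colon \mathbb{Z}/2\mathbb{Z} \to \mathrm{Aut}(A)$ be an action of $\mathbb{Z}/2\mathbb{Z}$ on $A$ by $*$-automorphisms, and let $A^{\alpha} = \{a \in A : \alpha_g(a) = a \text{ for all } g \in \mathbb{Z}/2\mathbb{Z}\}$ be its fixed point algebra. Let $D \subset A$ be a nonzero hereditary subalgebra, that is, a nonzero norm closed $*$-subalgebra such that $0 \le a \le b$ with $a \in A$ and $b \in D$ implies $a \in D$. Then there exists a nonzero hereditary subalgebra $B \subset A^{\alpha}$ which is $*$-isomorphic to a (not necessarily hereditary) C*-subalgebra of $D$. -/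

import Mathlib

/-- The fixed point algebra `A^α` of an action `α : G → Aut(A)` by `⋆`-automorphisms, as a
`⋆`-subalgebra of `A`. -/
def fixedPointAlgebra {G A : Type*} [Group G] [NonUnitalCStarAlgebra A]
    (α : G →* (A ≃⋆ₐ[ℂ] A)) : NonUnitalStarSubalgebra ℂ A where
  carrier := {a | ∀ g : G, α g a = a}
  add_mem' {a b} ha hb g := by rw [map_add, ha g, hb g]
  zero_mem' g := map_zero (α g)
  mul_mem' {a b} ha hb g := by rw [map_mul, ha g, hb g]
  smul_mem' c a ha g := by rw [map_smul, ha g]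
  star_mem' {a} ha g := by rw [map_star, ha g]

/-- A `⋆`-subalgebra `D` of `C` is a hereditary (C⋆-)subalgebra if it is norm closed and
`0 ≤ a ≤ b` with `a ∈ C` and `b ∈ D` implies `a ∈ D`.

This is used for a C⋆-algebra `C` with its usual order, and for a closed `⋆`-subalgebra `C` of a
C⋆-algebra with the order inherited from the latter, which is again the usual order of `C`
because an element of `C` is positive in `C` if and only if it is positive in the larger algebra. -/
def IsHereditarySubalgebra {C : Type*} [NonUnitalRing C] [StarRing C] [Module ℂ C]
    [TopologicalSpace C] [PartialOrder C] (D : NonUnitalStarSubalgebra ℂ C) : Prop :=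
  IsClosed (D : Set C) ∧ ∀ a b : C, 0 ≤ a → a ≤ b → b ∈ D → a ∈ D

/-! Let `σ` be the involution. If `w * star w ∈ D`, then `x ↦ w * x * star w` maps `A` into `D`. So
it suffices to find such a `w` for which this map is multiplicative, with a continuous left inverse,
on the fixed elements having some self-adjoint `e` as a unit; these elements form a hereditary
subalgebra of the fixed point algebra (`exists_hereditary_of_conjugation`). If `v * star v ∈ D` and
`star v * v` is fixed, a truncated polar part `w` of `v` works, with `e = star w * w`. Fix a nonzero
`d ∈ D`. If `d A σ(d*) ≠ 0`, it contains a nonzero `y` with `σ y = star y`. Then `σ` swaps `|y*|`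
and `|y|`, and since `|y*| y = y |y|`, the element `v = |y*| + y` has fixed `v* v`. If `d A σ(d*) =
0`, then `e = w* w`, built from `d`, and `σ e` generate orthogonal ideals. A fixed `x` with unit `e
+ σ e` is `exe + σ(exe)`, so compressing by `w` loses nothing. -/

section Hereditary

/-! ### Functional calculus and absolute values -/

variable {A : Type*} [NonUnitalCStarAlgebra A]

/-- An element `f` on which `w⋆w` acts as a unit for `w = v g`, where `g` and `f` are functions
of `h = v⋆v`. -/
theorem exists_truncated_unit [PartialOrder A] [StarOrderedRing A] {h : A} (hh : 0 ≤ h)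
    (h0 : h ≠ 0) : ∃ g f : A, IsSelfAdjoint g ∧ f ≠ 0 ∧
      g * h * g * f = f ∧ f * (g * h * g) = f ∧
      ∀ τ : A ≃⋆ₐ[ℂ] A, τ h = h → τ g = g ∧ τ f = f := by
  have hε : 0 < ‖h‖ / 2 := half_pos (norm_pos_iff.mpr h0)
  set ε := ‖h‖ / 2 with hεdef
  have hsa : IsSelfAdjoint h := .of_nonneg hh
  -- `G t = t ^ (-1/2)` for `t ≥ ε`, and `F` vanishes below `ε`. Both vanish at `0`, as the
  -- nonunital calculus requires.
  let G : ℝ → ℝ := fun t ↦ √t / max t ε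
  let F : ℝ → ℝ := fun t ↦ max (t - ε) 0
  have hG : Continuous G :=
    Real.continuous_sqrt.div₀ (by fun_prop) fun t ↦ (hε.trans_le (le_max_right t ε)).ne'
  have hF : Continuous F := by fun_prop
  have hG0 : G 0 = 0 := by simp [G]
  have hF0 : F 0 = 0 := by simp [F, hε.le]
  have hGtF : ∀ t, G t * t * G t * F t = F t := by
    intro t
    rcases le_total t ε with ht | ht
    · simp [F, ht]
    · have htpos : 0 < t := hε.trans_le ht
      have : G t * t * G t = 1 := by
        simp only [G, max_eq_left ht]
        have := Real.mul_self_sqrt htpos.le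
        field_simp
        nlinarith
      rw [this, one_mul]
  have hprod : cfcₙ G h * h * cfcₙ G h = cfcₙ (fun t ↦ G t * t * G t) h := by
    rw [cfcₙ_mul (fun t ↦ G t * t) G h (by fun_prop) (by simp) (by fun_prop) hG0,
      cfcₙ_mul G (fun t ↦ t) h (by fun_prop) hG0 (by fun_prop) rfl, cfcₙ_id' ℝ h]
  have hmul : cfcₙ G h * h * cfcₙ G h * cfcₙ F h = cfcₙ F h := by
    rw [hprod, ← cfcₙ_mul (fun t ↦ G t * t * G t) F h (by fun_prop) (by simp) (by fun_prop) hF0]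
    simp only [hGtF]
  refine ⟨cfcₙ G h, cfcₙ F h, cfcₙ_predicate G h, ?_, hmul, ?_, ?_⟩
  · intro hzero
    -- If `F(h) = 0`, then `h = min(h, ε)` has norm at most `ε = ‖h‖ / 2`, which is absurd.
    have hsplit : h = cfcₙ (fun t ↦ min t ε) h := by
      conv_lhs => rw [← cfcₙ_id' ℝ h]
      have : (fun t : ℝ ↦ t) = fun t ↦ min t ε + F t := by
        ext t
        rcases le_total t ε with ht | ht <;> simp [F, ht]
      rw [this, cfcₙ_add (fun t ↦ min t ε) F h (by fun_prop) (by simp [hε.le]) (by fun_prop) hF0,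
        hzero, add_zero]
    have hle : ‖h‖ ≤ ε := by
      rw [hsplit]
      refine norm_cfcₙ_le fun t ht ↦ ?_
      have ht0 : 0 ≤ t := quasispectrum_nonneg_of_nonneg h hh t ht
      rw [Real.norm_of_nonneg (le_min ht0 hε.le)]
      exact min_le_right _ _
    linarith
  · have := congrArg star hmul
    have hGsa : star (cfcₙ G h) = cfcₙ G h := cfcₙ_predicate (R := ℝ) G h
    have hFsa : star (cfcₙ F h) = cfcₙ F h := cfcₙ_predicate (R := ℝ) F h
    simpa only [star_mul, hGsa, hFsa, hsa.star_eq, mul_assoc] using this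
  · intro τ hτ
    have hτc : Continuous τ := (StarAlgEquiv.isometry τ).continuous
    have key : ∀ K : ℝ → ℝ, Continuous K → K 0 = 0 → τ (cfcₙ K h) = cfcₙ K h := by
      intro K hK hK0
      have := NonUnitalStarAlgHomClass.map_cfcₙ (S := ℂ) τ K h (by fun_prop) hK0 hτc hsa
        (by rw [hτ]; exact hsa)
      rw [this, hτ]
    exact ⟨key G hG hG0, key F hF hF0⟩

/-- `|y⋆| y = y |y|`. -/
theorem abs_star_mul_self [PartialOrder A] [StarOrderedRing A] (y : A) :
    CFC.abs (star y) * y = y * CFC.abs y := by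
  set s := CFC.abs (star y)
  set t := CFC.abs y
  have hs : 0 ≤ s := CFC.abs_nonneg _
  have ht : 0 ≤ t := CFC.abs_nonneg _
  have hss : s * s = y * star y := by simpa using CFC.abs_mul_abs (star y)
  have htt : t * t = star y * y := CFC.abs_mul_abs y
  have hssa : star s = s := (IsSelfAdjoint.of_nonneg hs).star_eq
  have htsa : star t = t := (IsSelfAdjoint.of_nonneg ht).star_eq
  -- From `s z = -z t`, the element `z* z t` equals `-z* s z ≤ 0`. Being self-adjoint, it is a
  -- product of commuting positive elements, hence also `≥ 0`. So it vanishes, which forces `z t =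
  -- 0`, `s z = 0` and finally `z = 0`.
  set z := y * t - s * y with hz
  have hanti : s * z = -(z * t) := by
    have : s * z + z * t = y * (t * t) - s * s * y := by rw [hz]; noncomm_ring
    rw [hss, htt] at this
    rw [eq_neg_iff_add_eq_zero, this]; noncomm_ring
  have hszz : star z * s * z = -(star z * z * t) := by
    rw [mul_assoc, hanti]; noncomm_ring
  have hcomm : star z * z * t = t * (star z * z) := by
    have := congrArg star hszz
    simp only [star_mul, star_neg, star_star, hssa, htsa, ← mul_assoc] at this
    rw [hszz] at this
    simpa [mul_assoc] using this
  have hpos : 0 ≤ star z * z * t :=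
    Commute.mul_nonneg (star_mul_self_nonneg z) ht hcomm
  have hneg : 0 ≤ -(star z * z * t) := hszz ▸ star_left_conjugate_nonneg hs z
  have hzero : star z * z * t = 0 := le_antisymm (neg_nonneg.mp hneg) hpos
  have hzt : z * t = 0 := by
    rw [← CStarRing.star_mul_self_eq_zero_iff]
    rw [star_mul, htsa, mul_assoc, ← mul_assoc (star z), hzero, mul_zero]
  have hsz : s * z = 0 := by rw [hanti, hzt, neg_zero]
  have htz : t * star z = 0 := by simpa [htsa] using congrArg star hzt
  have hzz : z * star z * z = 0 := by
    have : star z = t * star y - star y * s := by rw [hz]; simp [hssa, htsa]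
    calc z * star z * z = z * t * star y * z - z * star y * (s * z) := by
          rw [this]; noncomm_ring
      _ = 0 := by rw [hzt, hsz]; simp
  have : z = 0 := by
    rw [← CStarRing.star_mul_self_eq_zero_iff, ← CStarRing.star_mul_self_eq_zero_iff, star_mul,
      star_star, mul_assoc, ← mul_assoc z, hzz, mul_zero]
  exact (sub_eq_zero.mp this).symm

/-! ### Membership in a hereditary subalgebra -/

section Membership

variable [PartialOrder A] [StarOrderedRing A] {D : NonUnitalStarSubalgebra ℂ A}

/-- For positive `x`, `w x w* ≤ ‖x‖ w w*`; positive elements span `A`. -/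
theorem IsHereditarySubalgebra.conjugate_mem (hD : IsHereditarySubalgebra D) {w : A}
    (hw : w * star w ∈ D) (x : A) : w * x * star w ∈ D := by
  have hx : x ∈ Submodule.span ℂ {a : A | 0 ≤ a} := by
    rw [CStarAlgebra.span_nonneg]; trivial
  induction hx using Submodule.span_induction with
  | mem x hx =>
    refine hD.2 _ _ (star_right_conjugate_nonneg hx w)
      (CStarAlgebra.star_right_conjugate_le_norm_smul (.of_nonneg hx)) ?_
    have := SMulMemClass.smul_mem (‖x‖ : ℂ) hw
    rwa [Complex.coe_smul] at this
  | zero => simp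
  | add x y _ _ hx hy => rw [mul_add, add_mul]; exact add_mem hx hy
  | smul c x _ hx => rw [mul_smul_comm, smul_mul_assoc]; exact SMulMemClass.smul_mem c hx

theorem IsHereditarySubalgebra.mul_mul_star_mem (hD : IsHereditarySubalgebra D) {w : A}
    (hw : w * star w ∈ D) (x : A) : w * x * star (w * x) ∈ D := by
  simpa only [star_mul, mul_assoc] using hD.conjugate_mem hw (x * star x)

/-- By the parallelogram identity, `(v + w)(v + w)* ≤ 2 (v v* + w w*)`. -/
theorem IsHereditarySubalgebra.add_mul_star_mem (hD : IsHereditarySubalgebra D) {v w : A}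
    (hv : v * star v ∈ D) (hw : w * star w ∈ D) : (v + w) * star (v + w) ∈ D := by
  refine hD.2 _ ((2 : ℂ) • (v * star v + w * star w)) (mul_star_self_nonneg _) ?_
    (SMulMemClass.smul_mem (2 : ℂ) (add_mem hv hw))
  rw [← sub_nonneg]
  have : (2 : ℂ) • (v * star v + w * star w) - (v + w) * star (v + w) =
      (v - w) * star (v - w) := by
    rw [two_smul, star_add, star_sub]; noncomm_ring
  rw [this]
  exact mul_star_self_nonneg _

end Membership

/-- Formally `(1 - e) a (1 - e) ≤ (1 - e) b (1 - e) = 0`, so `√a (1 - e) = 0`. Square roots of `a`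
and `b - a` express this without a unit. -/
theorem isUnitFor_of_le [PartialOrder A] [StarOrderedRing A] {e a b : A} (he : star e = e)
    (ha : 0 ≤ a) (hab : a ≤ b) (hb : b * e = b) : e * a = a ∧ a * e = a := by
  have hb0 : 0 ≤ b := ha.trans hab
  have heb : e * b = b := by
    simpa [he, (IsSelfAdjoint.of_nonneg hb0).star_eq] using congrArg star hb
  set s := CFC.sqrt a
  have hss : s * s = a := CFC.sqrt_mul_sqrt_self a
  have hssa : star s = s := (IsSelfAdjoint.of_nonneg (CFC.sqrt_nonneg a)).star_eq
  set r := CFC.sqrt (b - a)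
  have hrr : r * r = b - a := CFC.sqrt_mul_sqrt_self (b - a) (sub_nonneg.mpr hab)
  have hrsa : star r = r := (IsSelfAdjoint.of_nonneg (CFC.sqrt_nonneg (b - a))).star_eq
  have hsum : star (s - s * e) * (s - s * e) + star (r - r * e) * (r - r * e) = 0 := by
    have : star (s - s * e) * (s - s * e) + star (r - r * e) * (r - r * e) =
        (s * s + r * r) - e * (s * s + r * r) -
          ((s * s + r * r) * e - e * ((s * s + r * r) * e)) := by
      rw [star_sub, star_sub, star_mul, star_mul, he, hssa, hrsa]; noncomm_ring
    rw [this, hss, hrr, add_sub_cancel, hb, heb]; simp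
  have hs0 : star (s - s * e) * (s - s * e) = 0 :=
    le_antisymm (hsum ▸ le_add_of_nonneg_right (star_mul_self_nonneg _)) (star_mul_self_nonneg _)
  rw [CStarRing.star_mul_self_eq_zero_iff, sub_eq_zero] at hs0
  have hae : a * e = a := by rw [← hss, mul_assoc, ← hs0]
  refine ⟨?_, hae⟩
  simpa [he, (IsSelfAdjoint.of_nonneg ha).star_eq] using congrArg star hae

/-! ### Embedding corners of the fixed point algebra -/

section Corner

variable {G : Type*} [Group G] (α : G →* (A ≃⋆ₐ[ℂ] A))

/-- The fixed elements for which a self-adjoint element `e` is a two-sided unit. -/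
def fixedUnitCorner (e : A) (he : star e = e) :
    NonUnitalStarSubalgebra ℂ (fixedPointAlgebra α) where
  carrier := {x | e * x = x ∧ (x : A) * e = x}
  add_mem' {x y} hx hy := by
    simp only [Set.mem_ofPred_eq, NonUnitalStarSubalgebra.coe_add] at hx hy ⊢
    rw [mul_add, add_mul, hx.1, hx.2, hy.1, hy.2]; exact ⟨rfl, rfl⟩
  zero_mem' := by simp
  mul_mem' {x y} hx hy := by
    simp only [Set.mem_ofPred_eq, NonUnitalStarSubalgebra.coe_mul] at hx hy ⊢
    rw [← mul_assoc, hx.1, mul_assoc, hy.2]; exact ⟨rfl, rfl⟩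
  smul_mem' c x hx := by
    simp only [Set.mem_ofPred_eq, NonUnitalStarSubalgebra.coe_smul] at hx ⊢
    rw [mul_smul_comm, smul_mul_assoc, hx.1, hx.2]; exact ⟨rfl, rfl⟩
  star_mem' {x} hx := by
    change e * star (x : A) = star (x : A) ∧ star (x : A) * e = star (x : A)
    exact ⟨by simpa [he] using congrArg star hx.2, by simpa [he] using congrArg star hx.1⟩

theorem mem_fixedUnitCorner {e : A} {he : star e = e} {x : fixedPointAlgebra α} :
    x ∈ fixedUnitCorner α e he ↔ e * x = x ∧ (x : A) * e = x := Iff.rfl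

theorem isClosed_fixedPointAlgebra : IsClosed (fixedPointAlgebra α : Set A) := by
  have : (fixedPointAlgebra α : Set A) = ⋂ g, {a | α g a = a} := by
    ext a; rw [Set.mem_iInter]; exact Iff.rfl
  rw [this]
  exact isClosed_iInter fun g ↦ isClosed_eq (StarAlgEquiv.isometry (α g)).continuous continuous_id

theorem isHereditarySubalgebra_fixedUnitCorner [PartialOrder A] [StarOrderedRing A] (e : A)
    (he : star e = e) : IsHereditarySubalgebra (fixedUnitCorner α e he) := by
  refine ⟨?_, fun a b ha hab hb ↦ isUnitFor_of_le he (by exact_mod_cast ha) hab hb.2⟩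
  exact (isClosed_eq (by fun_prop) (by fun_prop)).inter (isClosed_eq (by fun_prop) (by fun_prop))

/-- If `x ↦ w x w⋆` is multiplicative on the corner of fixed elements with unit `e`, with a
continuous left inverse, then it embeds this corner into any hereditary subalgebra
containing `w w⋆`. -/
theorem exists_hereditary_of_conjugation [PartialOrder A] [StarOrderedRing A]
    {D : NonUnitalStarSubalgebra ℂ A} (hD : IsHereditarySubalgebra D) {w e f : A}
    (hw : w * star w ∈ D) (he : star e = e) (hf : f ∈ fixedPointAlgebra α) (hf0 : f ≠ 0)
    (hef : e * f = f) (hfe : f * e = f)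
    (hmul : ∀ x y : A, e * x = x → x * e = x → x ∈ fixedPointAlgebra α → e * y = y →
      w * x * star w * (w * y * star w) = w * (x * y) * star w)
    {ψ : A → A} (hψ : Continuous ψ)
    (hinv : ∀ x : A, e * x = x → x * e = x → x ∈ fixedPointAlgebra α → ψ (w * x * star w) = x) :
    ∃ B : NonUnitalStarSubalgebra ℂ (fixedPointAlgebra α),
      IsHereditarySubalgebra B ∧ B ≠ ⊥ ∧
        ∃ C : NonUnitalStarSubalgebra ℂ A,
          IsClosed (C : Set A) ∧ C ≤ D ∧ Nonempty (B ≃⋆ₐ[ℂ] C) := by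
  let B := fixedUnitCorner α e he
  let φ : B →⋆ₙₐ[ℂ] A :=
    { toFun := fun x ↦ w * ((x : fixedPointAlgebra α) : A) * star w
      map_smul' := fun c x ↦ by simp [mul_smul_comm, smul_mul_assoc]
      map_zero' := by simp
      map_add' := fun x y ↦ by simp [mul_add, add_mul]
      map_mul' := fun x y ↦ (hmul _ _ x.2.1 x.2.2 x.1.2 y.2.1).symm
      map_star' := fun x ↦ by simp [mul_assoc] }
  have hφ : ∀ x : B, φ x = w * ((x : fixedPointAlgebra α) : A) * star w := fun _ ↦ rfl
  have hψφ : ∀ x : B, ψ (φ x) = ((x : fixedPointAlgebra α) : A) := fun x ↦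
    hinv _ x.2.1 x.2.2 x.1.2
  have hinj : Function.Injective φ := fun x y hxy ↦ by
    apply Subtype.ext; apply Subtype.ext
    rw [← hψφ x, hxy, hψφ y]
  refine ⟨B, isHereditarySubalgebra_fixedUnitCorner α e he, ?_, NonUnitalStarAlgHom.range φ,
    ?_, ?_, ⟨StarAlgEquiv.ofInjective' φ hinj⟩⟩
  · intro hbot
    have hmem : (⟨f, hf⟩ : fixedPointAlgebra α) ∈ B := ⟨hef, hfe⟩
    rw [hbot, NonUnitalStarAlgebra.mem_bot] at hmem
    exact hf0 (congrArg Subtype.val hmem)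
  -- The continuous left inverse `ψ` describes the range by closed conditions: `ψ c` lies in the
  -- corner and is sent back to `c`.
  · have hset : (NonUnitalStarAlgHom.range φ : Set A) =
        {c | ψ c ∈ fixedPointAlgebra α} ∩ ({c | e * ψ c = ψ c} ∩ ({c | ψ c * e = ψ c} ∩
          {c | w * ψ c * star w = c})) := by
      ext c
      constructor
      · rintro ⟨x, rfl⟩
        have h := hψφ x
        refine ⟨?_, ?_, ?_, ?_⟩
        · change ψ (φ x) ∈ fixedPointAlgebra α
          rw [h]; exact x.1.2
        · change e * ψ (φ x) = ψ (φ x)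
          rw [h]; exact x.2.1
        · change ψ (φ x) * e = ψ (φ x)
          rw [h]; exact x.2.2
        · change w * ψ (φ x) * star w = φ x
          rw [h, hφ]
      · rintro ⟨h1, h2, h3, h4⟩
        exact ⟨⟨⟨ψ c, h1⟩, h2, h3⟩, h4⟩
    rw [hset]
    refine ((isClosed_fixedPointAlgebra α).preimage hψ).inter (.inter ?_ (.inter ?_ ?_)) <;>
      exact isClosed_eq (by fun_prop) (by fun_prop)
  · rintro _ ⟨x, rfl⟩
    exact hD.conjugate_mem hw _

/-- A nonzero `v` with `v v⋆` in a hereditary subalgebra and `v⋆ v` fixed embeds a corner of the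
fixed point algebra. -/
theorem exists_hereditary_of_star_mul_self_mem_fixed [PartialOrder A] [StarOrderedRing A]
    {D : NonUnitalStarSubalgebra ℂ A} (hD : IsHereditarySubalgebra D) {v : A}
    (hv : v * star v ∈ D) (hv0 : v ≠ 0) (hfix : star v * v ∈ fixedPointAlgebra α) :
    ∃ B : NonUnitalStarSubalgebra ℂ (fixedPointAlgebra α),
      IsHereditarySubalgebra B ∧ B ≠ ⊥ ∧
        ∃ C : NonUnitalStarSubalgebra ℂ A,
          IsClosed (C : Set A) ∧ C ≤ D ∧ Nonempty (B ≃⋆ₐ[ℂ] C) := by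
  obtain ⟨g, f, hg, hf0, hef, hfe, hτ⟩ := exists_truncated_unit (star_mul_self_nonneg v)
    (mt (CStarRing.star_mul_self_eq_zero_iff _).mp hv0)
  have hww : star (v * g) * (v * g) = g * (star v * v) * g := by
    rw [star_mul, hg.star_eq]; noncomm_ring
  refine exists_hereditary_of_conjugation α hD (w := v * g) (e := star (v * g) * (v * g)) (f := f)
    (ψ := fun c ↦ star (v * g) * c * (v * g))
    (hD.mul_mul_star_mem hv g) (by simp [mul_assoc]) (fun k ↦ (hτ (α k) (hfix k)).2) hf0
    (by rw [hww, hef]) (by rw [hww, hfe]) ?_ (by fun_prop) ?_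
  · generalize v * g = w
    intro x y _ hx _ _
    calc w * x * star w * (w * y * star w) = w * (x * (star w * w)) * (y * star w) := by
          noncomm_ring
      _ = w * (x * y) * star w := by rw [hx]; noncomm_ring
  · generalize v * g = w
    intro x hx hx' _
    calc star w * (w * x * star w) * w = (star w * w * x) * (star w * w) := by noncomm_ring
      _ = x := by rw [hx, hx']

end Corner

/-! ### The two cases for the involution -/

section Involution

variable (α : Multiplicative (ZMod 2) →* (A ≃⋆ₐ[ℂ] A))

theorem involution_apply_apply (a : A) :
    α (Multiplicative.ofAdd 1) (α (Multiplicative.ofAdd 1) a) = a := by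
  have : α (Multiplicative.ofAdd 1) * α (Multiplicative.ofAdd 1) = 1 := by
    rw [← map_mul, ← ofAdd_add, show (1 : ZMod 2) + 1 = 0 from rfl, ofAdd_zero, map_one]
  exact DFunLike.congr_fun this a

theorem mem_fixedPointAlgebra_iff_involution {a : A} :
    a ∈ fixedPointAlgebra α ↔ α (Multiplicative.ofAdd 1) a = a := by
  refine ⟨fun h ↦ h _, fun h g ↦ ?_⟩
  obtain ⟨k, rfl⟩ := Multiplicative.ofAdd.surjective g
  fin_cases k
  · change α (Multiplicative.ofAdd 0) a = a
    rw [ofAdd_zero, map_one]; rfl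
  · exact h

variable [PartialOrder A] [StarOrderedRing A] {D : NonUnitalStarSubalgebra ℂ A}

/-- The case where `y` implements an equivalence between an element of `D` and its image under
the involution: `|y⋆| + y` has fixed `v⋆v`. -/
theorem exists_hereditary_of_map_eq_star (hD : IsHereditarySubalgebra D) {y : A}
    (hy : y * star y ∈ D) (hy0 : y ≠ 0) (hσ : α (Multiplicative.ofAdd 1) y = star y) :
    ∃ B : NonUnitalStarSubalgebra ℂ (fixedPointAlgebra α),
      IsHereditarySubalgebra B ∧ B ≠ ⊥ ∧
        ∃ C : NonUnitalStarSubalgebra ℂ A,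
          IsClosed (C : Set A) ∧ C ≤ D ∧ Nonempty (B ≃⋆ₐ[ℂ] C) := by
  set σ := α (Multiplicative.ofAdd 1)
  set s := CFC.abs (star y)
  set t := CFC.abs y
  have hss : s * s = y * star y := by simpa using CFC.abs_mul_abs (star y)
  have htt : t * t = star y * y := CFC.abs_mul_abs y
  have hssa : star s = s := (IsSelfAdjoint.of_nonneg (CFC.abs_nonneg (star y))).star_eq
  have htsa : star t = t := (IsSelfAdjoint.of_nonneg (CFC.abs_nonneg y)).star_eq
  have hσy : σ (star y) = y := by rw [map_star, hσ, star_star]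
  -- If `|y*| + y = 0`, then `y` is self-adjoint, hence fixed, and `v = y` serves instead.
  by_cases hv0 : s + y = 0
  · have hys : y = -s := (neg_eq_of_add_eq_zero_right hv0).symm
    refine exists_hereditary_of_star_mul_self_mem_fixed α hD hy hy0 ?_
    rw [mem_fixedPointAlgebra_iff_involution]
    have hysa : star y = y := by rw [hys, star_neg, hssa]
    change σ _ = _
    rw [map_mul, hσy, hσ, hysa]
  · refine exists_hereditary_of_star_mul_self_mem_fixed α hD (v := s + y)
      (hD.add_mul_star_mem (by rwa [hssa, hss]) hy) hv0 ?_
    rw [mem_fixedPointAlgebra_iff_involution]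
    change σ _ = _
    have hst : s * y = y * t := abs_star_mul_self y
    have hts : star y * s = t * star y := by simpa [hssa, htsa] using congrArg star hst
    -- `σ(y y*) = y* y`, and positive square roots are unique.
    have hσs : σ s = t := by
      symm
      refine CFC.sqrt_unique ?_ ?_
      · rw [← map_mul, hss, map_mul, hσ, hσy]
      · have : σ s = star (σ (CFC.sqrt s)) * σ (CFC.sqrt s) := by
          rw [← map_star, ← map_mul,
            (IsSelfAdjoint.of_nonneg (CFC.sqrt_nonneg s)).star_eq,
            CFC.sqrt_mul_sqrt_self s (CFC.abs_nonneg _)]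
        rw [this]
        exact star_mul_self_nonneg _
    have hexp : star (s + y) * (s + y) = y * star y + s * y + star y * s + star y * y := by
      rw [star_add, hssa, ← hss]; noncomm_ring
    rw [hexp, map_add, map_add, map_add, map_mul, map_mul, map_mul, map_mul, hσs, hσ, hσy,
      ← hst, ← hts]
    abel

/-- The case where `D` and its image under the involution generate orthogonal ideals. -/
theorem exists_hereditary_of_orthogonal (hD : IsHereditarySubalgebra D) {d : A} (hd : d ∈ D)
    (hd0 : d ≠ 0) (horth : ∀ z, d * z * α (Multiplicative.ofAdd 1) (star d) = 0) :
    ∃ B : NonUnitalStarSubalgebra ℂ (fixedPointAlgebra α),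
      IsHereditarySubalgebra B ∧ B ≠ ⊥ ∧
        ∃ C : NonUnitalStarSubalgebra ℂ A,
          IsClosed (C : Set A) ∧ C ≤ D ∧ Nonempty (B ≃⋆ₐ[ℂ] C) := by
  have hinvol := involution_apply_apply α
  have hfixed := @mem_fixedPointAlgebra_iff_involution _ _ α
  have hσc : Continuous (α (Multiplicative.ofAdd 1)) := (StarAlgEquiv.isometry _).continuous
  generalize α (Multiplicative.ofAdd 1) = σ at *
  obtain ⟨g, f, hg, hf0, hef, hfe, -⟩ := exists_truncated_unit (star_mul_self_nonneg d)
    (mt (CStarRing.star_mul_self_eq_zero_iff _).mp hd0)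
  have hww : star (d * g) * (d * g) = g * (star d * d) * g := by
    rw [star_mul, hg.star_eq]; noncomm_ring
  have hwD : d * g * star (d * g) ∈ D := hD.mul_mul_star_mem (mul_mem hd (star_mem hd)) g
  have hw0 : d * g * σ (star (d * g)) = 0 := by
    rw [star_mul, map_mul, ← mul_assoc, mul_assoc d, horth]
  have hwz : ∀ z, d * g * z * σ (star (d * g)) = 0 := fun z ↦ by
    rw [star_mul, map_mul, ← mul_assoc, mul_assoc (d * g), mul_assoc d, ← mul_assoc, ← mul_assoc,
      mul_assoc d, mul_assoc d, horth]
  rw [← hww] at hef hfe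
  generalize d * g = w at hef hfe hwD hw0 hwz
  have hσwz : ∀ z, σ w * z * star w = 0 := fun z ↦ by
    have := congrArg σ (hwz (σ z))
    simpa [hinvol] using this
  set e := star w * w with he
  have hesa : star e = e := by simp [he]
  have hσe : σ e = σ (star w) * σ w := map_mul _ _ _
  have heσe : e * σ e = 0 := by
    rw [hσe, he]
    calc star w * w * (σ (star w) * σ w) = star w * (w * σ (star w)) * σ w := by noncomm_ring
      _ = 0 := by rw [hw0]; simp
  have hσee : σ e * e = 0 := by
    have := congrArg star heσe
    simpa [hesa, ← map_star] using this
  have hσef : σ e * σ f = σ f := by rw [← map_mul, hef]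
  have hσfe : σ f * σ e = σ f := by rw [← map_mul, hfe]
  have h1 : e * σ f = 0 := by rw [← hσef, ← mul_assoc, heσe, zero_mul]
  have h2 : σ e * f = 0 := by rw [← hef, ← mul_assoc, hσee, zero_mul]
  have h3 : f * σ e = 0 := by rw [← hfe, mul_assoc, heσe, mul_zero]
  have h4 : σ f * e = 0 := by rw [← hσfe, mul_assoc, hσee, mul_zero]
  -- On the image of `x`, `star w * c * w` recovers `e x e`; its `σ`-image supplies the other block
  -- `σ(e) x σ(e)`.
  refine exists_hereditary_of_conjugation α hD (w := w) (e := e + σ e) (f := f + σ f)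
    (ψ := fun c ↦ star w * c * w + σ (star w * c * w)) hwD ?_ ?_ ?_ ?_ ?_ ?_ ?_ ?_
  · rw [star_add, ← map_star, hesa]
  · rw [hfixed, map_add, hinvol, add_comm]
  · intro h0
    apply hf0
    have := congrArg (e * ·) h0
    simpa [mul_add, hef, h1] using this
  · rw [add_mul, mul_add, mul_add, hef, h1, h2, hσef, add_zero, zero_add]
  · rw [add_mul, mul_add, mul_add, hfe, h3, h4, hσfe, add_zero, zero_add]
  · intro x y _ hx _ _
    have hcross : w * x * σ e * y * star w = 0 := by
      calc w * x * σ e * y * star w = w * x * σ (star w) * (σ w * y * star w) := by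
            rw [hσe]; noncomm_ring
        _ = 0 := by rw [hwz, zero_mul]
    calc w * x * star w * (w * y * star w) = w * (x * (e + σ e)) * y * star w
          - w * x * σ e * y * star w := by rw [he]; noncomm_ring
      _ = w * (x * y) * star w := by rw [hx, hcross, sub_zero]; noncomm_ring
  · fun_prop
  · intro x hx hx' hxfix
    rw [hfixed] at hxfix
    have hc1 : e * x * σ e = 0 := by
      calc e * x * σ e = star w * (w * x * σ (star w)) * σ w := by rw [hσe, he]; noncomm_ring
        _ = 0 := by rw [hwz]; simp
    have hc2 : σ e * x * e = 0 := by
      calc σ e * x * e = σ (star w) * (σ w * x * star w) * w := by rw [hσe, he]; noncomm_ring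
        _ = 0 := by rw [hσwz]; simp
    have hmid : star w * (w * x * star w) * w = e * x * e := by rw [he]; noncomm_ring
    change star w * (w * x * star w) * w + σ (star w * (w * x * star w) * w) = x
    rw [hmid, map_mul, map_mul, hxfix]
    calc e * x * e + σ e * x * σ e
        = (e + σ e) * x * (e + σ e) - e * x * σ e - σ e * x * e := by noncomm_ring
      _ = x := by rw [hc1, hc2, hx, hx', sub_zero, sub_zero]

end Involution

end Hereditary

theorem mainTheorem4 {A : Type*} [NonUnitalCStarAlgebra A] [PartialOrder A] [StarOrderedRing A]
    (α : Multiplicative (ZMod 2) →* (A ≃⋆ₐ[ℂ] A))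
    (D : NonUnitalStarSubalgebra ℂ A) (hD : IsHereditarySubalgebra D) (hD0 : D ≠ ⊥) :
    ∃ B : NonUnitalStarSubalgebra ℂ (fixedPointAlgebra α),
      IsHereditarySubalgebra B ∧ B ≠ ⊥ ∧
        ∃ C : NonUnitalStarSubalgebra ℂ A,
          IsClosed (C : Set A) ∧ C ≤ D ∧ Nonempty (B ≃⋆ₐ[ℂ] C) := by
  obtain ⟨d, hd, hd0⟩ : ∃ d ∈ D, d ≠ 0 := by
    by_contra! h
    exact hD0 (eq_bot_iff.mpr fun x hx ↦ NonUnitalStarAlgebra.mem_bot.mpr (h x hx))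
  by_cases horth : ∀ z, d * z * α (Multiplicative.ofAdd 1) (star d) = 0
  · exact exists_hereditary_of_orthogonal α hD hd hd0 horth
  push Not at horth
  obtain ⟨z, hz⟩ := horth
  have hinvol := involution_apply_apply α
  have hdd : d * star d ∈ D := mul_mem hd (star_mem hd)
  set σ := α (Multiplicative.ofAdd 1)
  set y := d * z * σ (star d) with hy
  have hyD : y * star y ∈ D := by
    rw [hy, mul_assoc d]; exact hD.mul_mul_star_mem hdd _
  -- `σ(y)*` again has left factor `d`, so symmetrizing `y` stays inside `d A`.
  have hσy : star (σ y) = d * (star (σ z) * σ (star d)) := by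
    rw [hy, map_mul, map_mul, hinvol, star_mul, star_mul, star_star, ← map_star σ d]
  have hσyD : star (σ y) * star (star (σ y)) ∈ D := by
    rw [hσy]; exact hD.mul_mul_star_mem hdd _
  -- If the symmetrization vanishes, then `σ y = -y*`, and the factor `i` corrects the sign.
  by_cases hsum : y + star (σ y) = 0
  · have hneg : star (σ y) = -y := (neg_eq_of_add_eq_zero_right hsum).symm
    have hσ : σ y = -star y := by simpa using congrArg star hneg
    refine exists_hereditary_of_map_eq_star α hD (y := Complex.I • y) ?_
      (smul_ne_zero Complex.I_ne_zero hz) ?_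
    · have : Complex.I • y * star (Complex.I • y) = y * star y := by
        rw [star_smul, smul_mul_smul_comm]; simp
      rwa [this]
    · change σ _ = _
      rw [map_smul, hσ, star_smul]; simp
  · refine exists_hereditary_of_map_eq_star α hD (hD.add_mul_star_mem hyD hσyD) hsum ?_
    change σ _ = _
    rw [map_add, ← map_star, hinvol, star_add, map_star, star_star, add_comm]
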